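/- Three users communicate through a relay in the linear-shift deterministic Y-channel with integer levels $n_1\ge n_2\ge n_3\ge 0$. Put $q=n_1$ and let $\mathbf S$ be the $q\times q$ downward shift matrix over $\mathbb F_2$. In time slot $i$ user $j\in\{1,2,3\}$ sends $\mathbf x_{ji}\in\mathbb F_2^q$ and the relay sends $\mathbf x_{ri}\in\mathbb F_2^q$; the relay receives $\mathbf y_{ri}=\sum_{j=1}^3\mathbf S^{q-n_j}\mathbf x_{ji}$ and user $j$ receives $\mathbf y_{ji}=\mathbf S^{q-n_j}\mathbf x_{ri}$. For every ordered pair $j\ne k$ user $j$ has a message $m_{jk}$ for user $k$, where the six messages are independent and $m_{jk}$ is uniformly distributed on $\{1,\dots,\lfloor 2^{nR_{jk}}\rfloor\}$, $R_{jk}\ge 0$. In a code of block length $n$, $\mathbf x_{ji}$ is a function of the two outgoing messages of user $j$ and of $\mathbf y_{j1},\dots,\mathbf y_{j,i-1}$; $\mathbf x_{ri}$ is a function of $\mathbf y_{r1},\dots,\mathbf y_{r,i-1}$; and user $j$ estimates its two incoming messages from $\mathbf y_{j1},\dots,\mathbf y_{jn}$ and its own two outgoing messages. An error occurs if some user estimates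 one of its incoming messages wrongly. A rate tuple $\vec R=(R_{12},R_{13},R_{21},R_{23},R_{31},R_{32})\in\mathbb R_+^6$ is achievable if there is a sequence of codes, one for each block length $n$, whose error probability tends to $0$ as $n\to\infty$. The capacity region $\mathcal C_d$ is the closure of the set of achievable rate tuples. Theorem. $\mathcal C_d=\overline{\mathcal C}_d$, where $\overline{\mathcal C}_d$ is the set of all $\vec R\in\mathbb R_+^6$ such that $$\begin{aligned} R_{31}+R_{32}&\le n_3, & R_{13}+R_{23}&\le n_3,\\ R_{12}+R_{32}+R_{13}&\le n_2, & R_{12}+R_{32}+R_{31}&\le n_1,\\ R_{21}+R_{31}+R_{32}&\le n_2, & R_{21}+R_{31}+R_{23}&\le n_2,\\ R_{13}+R_{23}+R_{12}&\le n_2, & R_{13}+R_{23}+R_{21}&\le n_1. \end{aligned}$$ -/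

import Mathlib

namespace DYC

/-- Ordered pairs `(j, k)` of distinct users: message `(j, k)` goes from user `j` to user `k`.
The three users are numbered `0, 1, 2` here (usually `1, 2, 3`). -/
abbrev Pair : Type := {p : Fin 3 × Fin 3 // p.1 ≠ p.2}

/- The six pairs, named with the usual numbering `1, 2, 3` of the users. -/
def p12 : Pair := ⟨(0, 1), by decide⟩
def p13 : Pair := ⟨(0, 2), by decide⟩
def p21 : Pair := ⟨(1, 0), by decide⟩
def p23 : Pair := ⟨(1, 2), by decide⟩
def p31 : Pair := ⟨(2, 0), by decide⟩
def p32 : Pair := ⟨(2, 1), by decide⟩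

/-- Binary column vectors of length `q`; entry `0` is the most significant bit. -/
abbrev Vec (q : ℕ) : Type := Fin q → ZMod 2

/-- The `q × q` downward shift matrix: `(S x) (b + 1) = x b` and `(S x) 0 = 0`. -/
def shift (q : ℕ) : Matrix (Fin q) (Fin q) (ZMod 2) :=
  Matrix.of fun a b => if (a : ℕ) = (b : ℕ) + 1 then 1 else 0

/-- Length of the binary vectors of the channel: the largest number of levels. -/
def dim (n : Fin 3 → ℕ) : ℕ := Finset.univ.sup n

/-- The link between user `j` and the relay (the same in both directions). -/
def link (n : Fin 3 → ℕ) (j : Fin 3) (x : Vec (dim n)) : Vec (dim n) :=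
  (shift (dim n) ^ (dim n - n j)).mulVec x

/-- Tuples of six messages, message `p` being taken from a set of `M p` elements. -/
abbrev Messages (M : Pair → ℕ) : Type := ∀ p : Pair, Fin (M p)

/-- The two messages that originate at user `j`. -/
abbrev Outgoing (M : Pair → ℕ) (j : Fin 3) : Type :=
  ∀ k : {k : Fin 3 // k ≠ j}, Fin (M ⟨(j, k), k.2.symm⟩)

/-- The two messages that are intended for user `j`. -/
abbrev Incoming (M : Pair → ℕ) (j : Fin 3) : Type :=
  ∀ k : {k : Fin 3 // k ≠ j}, Fin (M ⟨(k, j), k.2⟩)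

def outgoing {M : Pair → ℕ} (m : Messages M) (j : Fin 3) : Outgoing M j :=
  fun k => m ⟨(j, k), k.2.symm⟩

def incoming {M : Pair → ℕ} (m : Messages M) (j : Fin 3) : Incoming M j :=
  fun k => m ⟨(k, j), k.2⟩

/-- A code of block length `N` with message sets of sizes `M` and symbols in `𝔽₂ ^ q`. At time `i`
a user knows its outgoing messages and its receptions at times `t < i`, the relay knows its
receptions at times `t < i`. User `j` decodes from all its receptions and its own messages. -/
structure Code (q N : ℕ) (M : Pair → ℕ) where
  userEnc : ∀ (j : Fin 3) (i : Fin N), Outgoing M j → (Fin (i : ℕ) → Vec q) → Vec q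
  relayEnc : ∀ i : Fin N, (Fin (i : ℕ) → Vec q) → Vec q
  dec : ∀ j : Fin 3, (Fin N → Vec q) → Outgoing M j → Incoming M j

/-- What is received at time `i` when the messages are `m`: the first component at the relay,
the second one at each of the users. -/
def received {n : Fin 3 → ℕ} {N : ℕ} {M : Pair → ℕ} (c : Code (dim n) N M) (m : Messages M)
    (i : Fin N) : Vec (dim n) × (Fin 3 → Vec (dim n)) :=
  (∑ j : Fin 3, link n j
      (c.userEnc j i (outgoing m j) fun t => (received c m ⟨t, t.2.trans i.2⟩).2 j),
    fun j => link n j (c.relayEnc i fun t => (received c m ⟨t, t.2.trans i.2⟩).1))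
termination_by (i : ℕ)
decreasing_by all_goals exact t.2

/-- Some user decodes at least one of its two desired messages wrongly. -/
def IsError {n : Fin 3 → ℕ} {N : ℕ} {M : Pair → ℕ} (c : Code (dim n) N M) (m : Messages M) : Prop :=
  ∃ j : Fin 3, c.dec j (fun i => (received c m i).2 j) (outgoing m j) ≠ incoming m j

open Classical in
/-- Average error probability, for independent and uniformly distributed messages. -/
noncomputable def errorProb {n : Fin 3 → ℕ} {N : ℕ} {M : Pair → ℕ} (c : Code (dim n) N M) : ℝ :=
  ((Finset.univ.filter fun m : Messages M => IsError c m).card : ℝ) / Fintype.card (Messages M)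

/-- Sizes of the message sets `{1, …, 2 ^ (N * R p)}` at block length `N`. -/
noncomputable def messageSize (R : Pair → ℝ) (N : ℕ) (p : Pair) : ℕ :=
  ⌊(2 : ℝ) ^ ((N : ℝ) * R p)⌋₊

/-- The rate tuple `R` is achievable over the deterministic Y-channel with levels `n`. -/
def Achievable (n : Fin 3 → ℕ) (R : Pair → ℝ) : Prop :=
  (∀ p, 0 ≤ R p) ∧ ∃ c : ∀ N : ℕ, Code (dim n) N (messageSize R N),
    Filter.Tendsto (fun N => errorProb (c N)) Filter.atTop (nhds 0)

/-- The capacity region: the closure of the set of achievable rate tuples. (Since the relay is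
strictly causal, one time slot is lost and boundary points need not be achieved exactly.) -/
def capacityRegion (n : Fin 3 → ℕ) : Set (Pair → ℝ) :=
  closure {R | Achievable n R}

/-- The polytope cut out of the nonnegative orthant by two cut-set and six genie-aided bounds. -/
def polytope (n₁ n₂ n₃ : ℕ) : Set (Pair → ℝ) :=
  {R | (∀ p, 0 ≤ R p) ∧
    R p31 + R p32 ≤ n₃ ∧
    R p13 + R p23 ≤ n₃ ∧
    R p12 + R p32 + R p13 ≤ n₂ ∧
    R p12 + R p32 + R p31 ≤ n₁ ∧
    R p21 + R p31 + R p32 ≤ n₂ ∧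
    R p21 + R p31 + R p23 ≤ n₂ ∧
    R p13 + R p23 + R p12 ≤ n₂ ∧
    R p13 + R p23 + R p21 ≤ n₁}

end DYC

/-! Converse: a single counting argument gives all eight bounds. If the correctly decoded tuples are
determined by the messages outside `F` together with `d` bits per time slot, then the rates in `F`
sum to at most `d` (`correct_mul_prod_le`, `le_of_forall_correct`). The bits are either the top `d`
entries of the relay signal or the part of the relay's reception caused by some of the users.

The six bounds with three rates correspond to the six transitive orientations of the triangle of
users. For an orientation `i → j → k`, `i → k`, the downlink to `j, k` gives the bound `max (n j) (n
k)`, and the uplink from `i, j` gives `max (n i) (n j)`. The polytope uses the smaller of the two.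

Achievability: the relay forwards sums of bits. A bidirectional pair of bits needs one sum, and
three bits along an oriented cycle need two. After greedy pairing, at most one message per pair of
users has bits left. If these leftovers form a cycle, cyclic sums use up the smallest of them; what
is left is acyclic and is sent uncoded, and the polytope bounds ensure that the load fits
(`exists_decomposition`). Hall's theorem places the sums on levels (`exists_roundTrip`), and
pipelining the blocks through the relay costs one block (`blockCode_not_isError`). Real rates are
approximated by integer points of the `T`-fold channel (`achievable_of_natCast`). -/

namespace DYC

/-! ### Links: shifts as access to the top or bottom levels -/

section Link

variable {n : Fin 3 → ℕ}

lemma shift_pow_apply (q d : ℕ) (a b : Fin q) :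
    (shift q ^ d) a b = if (a : ℕ) = (b : ℕ) + d then 1 else 0 := by
  induction d generalizing a b with
  | zero => simp [Matrix.one_apply, Fin.ext_iff]
  | succ d ih =>
    rw [pow_succ, Matrix.mul_apply]
    simp only [ih]
    by_cases h : (b : ℕ) + 1 < q
    · rw [Finset.sum_eq_single (⟨b + 1, h⟩ : Fin q)]
      · simp [shift, add_assoc, add_comm 1 d]
      · intro x _ hx
        have : (x : ℕ) ≠ b + 1 := fun h' => hx (Fin.ext h')
        simp [shift, this]
      · simp
    · rw [Finset.sum_eq_zero]
      · have : (a : ℕ) ≠ b + (d + 1) := by have := a.2; omega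
        simp [this]
      · intro x _
        have : (x : ℕ) ≠ b + 1 := by have := x.2; omega
        simp [shift, this]

lemma le_dim (n : Fin 3 → ℕ) (j : Fin 3) : n j ≤ dim n := Finset.le_sup (Finset.mem_univ j)

lemma link_apply_of_lt (j : Fin 3) (x : Vec (dim n)) (a : Fin (dim n))
    (h : (a : ℕ) < dim n - n j) : link n j x a = 0 := by
  simp only [link, Matrix.mulVec, dotProduct, shift_pow_apply]
  refine Finset.sum_eq_zero fun b _ => ?_
  rw [if_neg (by omega), zero_mul]

lemma link_apply_of_le (j : Fin 3) (x : Vec (dim n)) (a : Fin (dim n))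
    (h : dim n - n j ≤ (a : ℕ)) :
    link n j x a = x ⟨a - (dim n - n j), (Nat.sub_le _ _).trans_lt a.2⟩ := by
  simp only [link, Matrix.mulVec, dotProduct, shift_pow_apply]
  rw [Finset.sum_eq_single ⟨a - (dim n - n j), (Nat.sub_le _ _).trans_lt a.2⟩]
  · rw [if_pos (by simp; omega), one_mul]
  · intro b _ hb
    rw [if_neg, zero_mul]
    intro h'
    exact hb (Fin.ext (by simp; omega))
  · simp

/-- What user `j` receives depends only on the top `n j` entries of the relay signal. -/
lemma link_congr (j : Fin 3) {x x' : Vec (dim n)}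
    (h : ∀ b : Fin (dim n), (b : ℕ) < n j → x b = x' b) : link n j x = link n j x' := by
  funext a
  rcases lt_or_ge (a : ℕ) (dim n - n j) with ha | ha
  · rw [link_apply_of_lt j x a ha, link_apply_of_lt j x' a ha]
  · rw [link_apply_of_le j x a ha, link_apply_of_le j x' a ha]
    apply h
    have := a.2
    have := le_dim n j
    simp only
    omega

/-- The top `n j` entries of the relay signal can be read off by user `j`. -/
lemma link_read (j : Fin 3) (x : Vec (dim n)) (b : Fin (dim n)) (hb : (b : ℕ) < n j) :
    link n j x ⟨b + (dim n - n j), by have := le_dim n j; omega⟩ = x b := by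
  rw [link_apply_of_le _ _ _ (by simp)]
  congr 1
  exact Fin.ext (by simp)

/-- A user can produce any signal at the relay that is supported on its levels. -/
lemma exists_link_eq (j : Fin 3) (y : Vec (dim n))
    (hy : ∀ a : Fin (dim n), (a : ℕ) < dim n - n j → y a = 0) : ∃ x, link n j x = y := by
  refine ⟨fun b => if h : (b : ℕ) + (dim n - n j) < dim n then y ⟨b + (dim n - n j), h⟩ else 0, ?_⟩
  funext a
  rcases lt_or_ge (a : ℕ) (dim n - n j) with ha | ha
  · rw [link_apply_of_lt j _ a ha, hy a ha]
  · rw [link_apply_of_le j _ a ha]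
    have h : (a : ℕ) - (dim n - n j) + (dim n - n j) = a := by omega
    simp [h]

end Link

/-! ### Converse: counting correctly decoded tuples -/

section Converse

variable {n : Fin 3 → ℕ} {N : ℕ} {M : Pair → ℕ}

/-- If the correctly decoded message tuples are determined by the messages outside `F` and by an
observation `φ` with values in `Φ`, then there are few of them. -/
lemma correct_mul_prod_le (c : Code (dim n) N M) (hM : ∀ p, 0 < M p) (F : Finset Pair)
    {Φ : Type} [Fintype Φ] (φ : Messages M → Φ)
    (hφ : ∀ m m' : Messages M, ¬ IsError c m → ¬ IsError c m' → (∀ p ∉ F, m p = m' p) →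
      φ m = φ m' → m = m') :
    (1 - errorProb c) * ∏ p ∈ F, (M p : ℝ) ≤ Fintype.card Φ := by
  classical
  have hinj : Function.Injective
      (fun m : {m : Messages M // ¬ IsError c m} =>
        ((φ m.1, fun p => m.1 p.1) : Φ × (∀ p : {p : Pair // p ∉ F}, Fin (M p.1)))) := by
    intro m m' h
    simp only [Prod.mk.injEq] at h
    exact Subtype.ext (hφ _ _ m.2 m'.2 (fun p hp => congrFun h.2 ⟨p, hp⟩) h.1)
  have h1 := Fintype.card_le_of_injective _ hinj
  rw [Fintype.card_prod, Fintype.card_pi, Fintype.card_subtype_compl, Fintype.card_subtype] at h1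
  simp only [Fintype.card_fin] at h1
  have h2 : ∏ p : {p : Pair // p ∉ F}, M p.1 = ∏ p ∈ Fᶜ, M p := by
    rw [← Finset.prod_subtype (Fᶜ) (f := M) (by simp)]
  have h3 : (Finset.univ.filter fun m : Messages M => IsError c m).card ≤
      Fintype.card (Messages M) := Finset.card_le_univ _
  have h4 : Fintype.card (Messages M) = (∏ p ∈ F, M p) * ∏ p ∈ Fᶜ, M p := by
    rw [Finset.prod_mul_prod_compl]; simp
  have hpos : 0 < ∏ p ∈ Fᶜ, M p := Finset.prod_pos fun p _ => hM p
  have hpos' : 0 < ∏ p ∈ F, M p := Finset.prod_pos fun p _ => hM p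
  rw [h2] at h1
  have h5 : (Fintype.card (Messages M) : ℝ) -
      (Finset.univ.filter fun m : Messages M => IsError c m).card ≤
      Fintype.card Φ * ∏ p ∈ Fᶜ, (M p : ℝ) := by
    rw [← Nat.cast_sub h3]
    exact_mod_cast h1
  have hF : (0 : ℝ) < ∏ p ∈ F, (M p : ℝ) := by exact_mod_cast hpos'
  have hFc : (0 : ℝ) < ∏ p ∈ Fᶜ, (M p : ℝ) := by exact_mod_cast hpos
  have h6 : (Fintype.card (Messages M) : ℝ) = (∏ p ∈ F, (M p : ℝ)) * ∏ p ∈ Fᶜ, (M p : ℝ) := by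
    exact_mod_cast h4
  have h7 : (Finset.univ.filter fun m : Messages M => IsError c m).card =
      errorProb c * ((∏ p ∈ F, (M p : ℝ)) * ∏ p ∈ Fᶜ, (M p : ℝ)) := by
    rw [errorProb, ← h6]
    have : (Fintype.card (Messages M) : ℝ) ≠ 0 := by rw [h6]; positivity
    field_simp
  rw [h7, h6] at h5
  refine le_of_mul_le_mul_right ?_ hFc
  linarith

lemma incoming_eq (c : Code (dim n) N M) {m m' : Messages M} (hm : ¬ IsError c m)
    (hm' : ¬ IsError c m') (j : Fin 3) (ho : outgoing m j = outgoing m' j)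
    (hr : ∀ i, (received c m i).2 j = (received c m' i).2 j) : incoming m j = incoming m' j := by
  simp only [IsError, not_exists, not_not] at hm hm'
  rw [← hm j, ← hm' j, ho]
  simp only [hr]

/-- The signal transmitted by the relay at time `i`. -/
def relaySignal (c : Code (dim n) N M) (m : Messages M) (i : Fin N) : Vec (dim n) :=
  c.relayEnc i fun t => (received c m ⟨t, t.2.trans i.2⟩).1

/-- The signal transmitted by user `j` at time `i`. -/
def userSignal (c : Code (dim n) N M) (m : Messages M) (j : Fin 3) (i : Fin N) : Vec (dim n) :=
  c.userEnc j i (outgoing m j) fun t => (received c m ⟨t, t.2.trans i.2⟩).2 j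

lemma received_fst (c : Code (dim n) N M) (m : Messages M) (i : Fin N) :
    (received c m i).1 = ∑ j, link n j (userSignal c m j i) := by
  rw [received]; rfl

lemma received_snd (c : Code (dim n) N M) (m : Messages M) (i : Fin N) (j : Fin 3) :
    (received c m i).2 j = link n j (relaySignal c m i) := by
  rw [received]; rfl

lemma sum_eq_add_sum (K : Finset (Fin 3)) (f : Fin 3 → Vec (dim n)) :
    ∑ j, f j = ∑ j ∈ K, f j + ∑ j ∈ Kᶜ, f j := (Finset.sum_add_sum_compl K f).symm

/-- The relay signals, restricted to their top `d` entries. -/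
def downlinkView (d : ℕ) (hd : d ≤ dim n) (c : Code (dim n) N M) (m : Messages M) :
    Fin N → Fin d → ZMod 2 :=
  fun i b => relaySignal c m i ⟨b, b.2.trans_le hd⟩

/-- The relay receptions due to the users outside `K`, restricted to their bottom `d` entries. -/
def uplinkView (d : ℕ) (hd : d ≤ dim n) (K : Finset (Fin 3)) (c : Code (dim n) N M)
    (m : Messages M) : Fin N → Fin d → ZMod 2 :=
  fun i b => (∑ j ∈ Kᶜ, link n j (userSignal c m j i)) ⟨b + (dim n - d), by omega⟩

lemma received_snd_eq_of_downlinkView {d : ℕ} {hd : d ≤ dim n} {c : Code (dim n) N M}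
    {m m' : Messages M} (h : downlinkView d hd c m = downlinkView d hd c m') (j : Fin 3)
    (hj : n j ≤ d) (i : Fin N) : (received c m i).2 j = (received c m' i).2 j := by
  rw [received_snd, received_snd]
  refine link_congr j fun b hb => ?_
  exact congrFun (congrFun h i) ⟨b, hb.trans_le hj⟩

/-- Induction on time: equal past receptions and equal outgoing messages fix the inputs of the users
in `K`. The view supplies the contribution of the others, who are too weak to reach the rows above
the bottom `d`. -/
lemma received_eq_of_uplinkView {d : ℕ} {hd : d ≤ dim n} {K : Finset (Fin 3)}
    {c : Code (dim n) N M} {m m' : Messages M}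
    (h : uplinkView d hd K c m = uplinkView d hd K c m')
    (hK : ∀ j ∉ K, n j ≤ d) (ho : ∀ j ∈ K, outgoing m j = outgoing m' j) (i : Fin N) :
    received c m i = received c m' i := by
  obtain ⟨i, hi⟩ := i
  induction i using Nat.strong_induction_on with
  | _ i ih =>
    have hpast : ∀ t : Fin i, received c m ⟨t, t.2.trans hi⟩ = received c m' ⟨t, t.2.trans hi⟩ :=
      fun t => ih t t.2 _
    refine Prod.ext ?_ (funext fun j => ?_)
    · rw [received_fst, received_fst, sum_eq_add_sum K, sum_eq_add_sum K]
      congr 1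
      · refine Finset.sum_congr rfl fun j hj => ?_
        simp only [userSignal, ho j hj, hpast]
      · funext a
        rcases lt_or_ge (a : ℕ) (dim n - d) with ha | ha
        · rw [Finset.sum_apply, Finset.sum_apply]
          refine Finset.sum_congr rfl fun j hj => ?_
          have := hK j (Finset.mem_compl.1 hj)
          rw [link_apply_of_lt _ _ _ (by omega), link_apply_of_lt _ _ _ (by omega)]
        · have := congrFun (congrFun h ⟨i, hi⟩) ⟨a - (dim n - d), by have := a.2; omega⟩
          simp only [uplinkView] at this
          convert this using 2 <;> exact Fin.ext (by simp; omega)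
    · rw [received_snd, received_snd]
      simp only [relaySignal, hpast]

lemma le_of_forall_correct {R : Pair → ℝ} (hR : ∀ p, 0 ≤ R p) (F : Finset Pair) (d : ℕ)
    (e : ℕ → ℝ) (he : Filter.Tendsto e Filter.atTop (nhds 0))
    (h : ∀ N, (1 - e N) * ∏ p ∈ F, (messageSize R N p : ℝ) ≤ 2 ^ (d * N)) :
    ∑ p ∈ F, R p ≤ d := by
  by_contra! hlt
  -- Taking the floor of a number that is at least 1 loses at most a factor 2.
  have hsize : ∀ (N : ℕ) p, (2 : ℝ) ^ ((N : ℝ) * R p) / 2 ≤ messageSize R N p := by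
    intro N p
    have h1 : (1 : ℝ) ≤ 2 ^ ((N : ℝ) * R p) :=
      Real.one_le_rpow (by norm_num) (mul_nonneg (Nat.cast_nonneg _) (hR p))
    have h2 := Nat.lt_floor_add_one ((2 : ℝ) ^ ((N : ℝ) * R p))
    have h3 : (1 : ℝ) ≤ messageSize R N p := by
      exact_mod_cast (Nat.one_le_floor_iff _).2 h1
    simp only [messageSize] at h3 ⊢
    linarith
  have hprod : ∀ N : ℕ, (2 : ℝ) ^ ((N : ℝ) * ∑ p ∈ F, R p) / 2 ^ F.card ≤
      ∏ p ∈ F, (messageSize R N p : ℝ) := by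
    intro N
    have := Finset.prod_le_prod (s := F) (f := fun p => (2 : ℝ) ^ ((N : ℝ) * R p) / 2)
      (fun p _ => by positivity) (fun p _ => hsize N p)
    rw [Finset.prod_div_distrib, Finset.prod_const, ← Real.rpow_sum_of_pos (by norm_num),
      ← Finset.mul_sum] at this
    exact this
  have hhalf : ∀ᶠ N in Filter.atTop, e N < 1 / 2 := he.eventually_lt_const (by norm_num)
  have hδ : 0 < ∑ p ∈ F, R p - d := sub_pos.2 hlt
  -- The bits lost: one per floor, and one for the factor `1 - e N > 1 / 2`. The linear excess in
  -- `N` beats this constant.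
  have hlarge : ∀ᶠ N : ℕ in Filter.atTop,
      (F.card + 1 : ℝ) < (N : ℝ) * (∑ p ∈ F, R p - d) :=
    (tendsto_natCast_atTop_atTop.atTop_mul_const hδ).eventually_gt_atTop _
  obtain ⟨N, hN1, hN2⟩ := (hhalf.and hlarge).exists
  have h1 : (1 / 2 : ℝ) * ((2 : ℝ) ^ ((N : ℝ) * ∑ p ∈ F, R p) / 2 ^ F.card) ≤ 2 ^ (d * N) := by
    refine le_trans ?_ (h N)
    exact mul_le_mul (by linarith) (hprod N) (by positivity) (by linarith)
  have h2 : (2 : ℝ) ^ ((N : ℝ) * ∑ p ∈ F, R p) ≤ 2 ^ (d * N + F.card + 1) := by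
    rw [pow_succ, pow_add]
    have : (0 : ℝ) < 2 ^ F.card := by positivity
    field_simp at h1
    linarith
  rw [← Real.rpow_natCast, Real.rpow_le_rpow_left_iff (by norm_num)] at h2
  push_cast at h2
  linarith

lemma messageSize_pos {R : Pair → ℝ} (hR : ∀ p, 0 ≤ R p) (N : ℕ) (p : Pair) :
    0 < messageSize R N p :=
  (Nat.one_le_floor_iff _).2
    (Real.one_le_rpow (by norm_num) (mul_nonneg (Nat.cast_nonneg _) (hR p)))

lemma sum_le_of_views {R : Pair → ℝ} (h : Achievable n R) (F : Finset Pair) (d : ℕ)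
    (φ : ∀ N, Code (dim n) N (messageSize R N) → Messages (messageSize R N) →
      Fin N → Fin d → ZMod 2)
    (hφ : ∀ N (c : Code (dim n) N (messageSize R N)) (m m' : Messages (messageSize R N)),
      ¬ IsError c m → ¬ IsError c m' → (∀ p ∉ F, m p = m' p) → φ N c m = φ N c m' → m = m') :
    ∑ p ∈ F, R p ≤ d := by
  obtain ⟨hR, c, hc⟩ := h
  refine le_of_forall_correct hR F d _ hc fun N => ?_
  refine (correct_mul_prod_le (c N) (messageSize_pos hR N) F (φ N (c N)) (hφ N (c N))).trans ?_
  simp [ZMod.card, pow_mul]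

lemma forall_pair {P : Pair → Prop} (h12 : P p12) (h13 : P p13) (h21 : P p21) (h23 : P p23)
    (h31 : P p31) (h32 : P p32) (p : Pair) : P p := by
  obtain ⟨⟨j, k⟩, hjk⟩ := p
  fin_cases j <;> fin_cases k <;> first | exact absurd rfl hjk | assumption

lemma messages_ext {m m' : Messages M} (h12 : m p12 = m' p12) (h13 : m p13 = m' p13)
    (h21 : m p21 = m' p21) (h23 : m p23 = m' p23) (h31 : m p31 = m' p31)
    (h32 : m p32 = m' p32) : m = m' :=
  funext (forall_pair h12 h13 h21 h23 h31 h32)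

lemma outgoing_eq_zero {m m' : Messages M} (h : m p12 = m' p12) (h' : m p13 = m' p13) :
    outgoing m 0 = outgoing m' 0 := by
  funext ⟨k, hk⟩
  fin_cases k <;> first | exact absurd rfl hk | assumption

lemma outgoing_eq_one {m m' : Messages M} (h : m p21 = m' p21) (h' : m p23 = m' p23) :
    outgoing m 1 = outgoing m' 1 := by
  funext ⟨k, hk⟩
  fin_cases k <;> first | exact absurd rfl hk | assumption

lemma outgoing_eq_two {m m' : Messages M} (h : m p31 = m' p31) (h' : m p32 = m' p32) :
    outgoing m 2 = outgoing m' 2 := by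
  funext ⟨k, hk⟩
  fin_cases k <;> first | exact absurd rfl hk | assumption

lemma eq_of_incoming_zero {m m' : Messages M} (h : incoming m 0 = incoming m' 0) :
    m p21 = m' p21 ∧ m p31 = m' p31 :=
  ⟨congrFun h ⟨1, by decide⟩, congrFun h ⟨2, by decide⟩⟩

lemma eq_of_incoming_one {m m' : Messages M} (h : incoming m 1 = incoming m' 1) :
    m p12 = m' p12 ∧ m p32 = m' p32 :=
  ⟨congrFun h ⟨0, by decide⟩, congrFun h ⟨2, by decide⟩⟩

lemma eq_of_incoming_two {m m' : Messages M} (h : incoming m 2 = incoming m' 2) :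
    m p13 = m' p13 ∧ m p23 = m' p23 :=
  ⟨congrFun h ⟨0, by decide⟩, congrFun h ⟨1, by decide⟩⟩

/-- In each three-rate bound one user decodes two messages of `F`; with the messages outside `F`
this completes the side information of a second user, who then decodes the third. -/
lemma achievable_mem_polytope {n₁ n₂ n₃ : ℕ} (h₁₂ : n₂ ≤ n₁) (h₂₃ : n₃ ≤ n₂) {R : Pair → ℝ}
    (h : Achievable ![n₁, n₂, n₃] R) : R ∈ polytope n₁ n₂ n₃ := by
  have d1 : n₁ ≤ dim ![n₁, n₂, n₃] := le_dim ![n₁, n₂, n₃] 0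
  have d2 : n₂ ≤ dim ![n₁, n₂, n₃] := le_dim ![n₁, n₂, n₃] 1
  have d3 : n₃ ≤ dim ![n₁, n₂, n₃] := le_dim ![n₁, n₂, n₃] 2
  have l1 : ∀ j, ![n₁, n₂, n₃] j ≤ n₁ := by
    intro j; fin_cases j <;> simp <;> omega
  have l2 : ∀ j, j ≠ 0 → ![n₁, n₂, n₃] j ≤ n₂ := by
    intro j hj; fin_cases j <;> simp at hj ⊢; omega
  have l3 : ∀ j, j = 2 → ![n₁, n₂, n₃] j ≤ n₃ := by
    rintro j rfl; simp
  refine ⟨h.1, ?_, ?_, ?_, ?_, ?_, ?_, ?_, ?_⟩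
  · have := sum_le_of_views h {p31, p32} n₃ (fun N c => uplinkView n₃ d3 {0, 1} c) ?_
    · rwa [Finset.sum_pair (by decide)] at this
    · intro N c m m' hm hm' hp hv
      have e12 := hp p12 (by decide)
      have e13 := hp p13 (by decide)
      have e21 := hp p21 (by decide)
      have e23 := hp p23 (by decide)
      have o0 := outgoing_eq_zero e12 e13
      have o1 := outgoing_eq_one e21 e23
      have hr := received_eq_of_uplinkView hv
        (fun j hj => l3 j (by revert hj; revert j; decide))
        (by simp [o0, o1])
      obtain ⟨-, e31⟩ := eq_of_incoming_zero (incoming_eq c hm hm' 0 o0 fun i => by rw [hr])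
      obtain ⟨-, e32⟩ := eq_of_incoming_one (incoming_eq c hm hm' 1 o1 fun i => by rw [hr])
      exact messages_ext e12 e13 e21 e23 e31 e32
  · have := sum_le_of_views h {p13, p23} n₃ (fun N c => downlinkView n₃ d3 c) ?_
    · rwa [Finset.sum_pair (by decide)] at this
    · intro N c m m' hm hm' hp hv
      have e12 := hp p12 (by decide)
      have e21 := hp p21 (by decide)
      have e31 := hp p31 (by decide)
      have e32 := hp p32 (by decide)
      obtain ⟨e13, e23⟩ := eq_of_incoming_two (incoming_eq c hm hm' 2 (outgoing_eq_two e31 e32)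
        (received_snd_eq_of_downlinkView hv 2 (l3 2 rfl)))
      exact messages_ext e12 e13 e21 e23 e31 e32
  -- The top `n₂` entries determine the receptions of users 2 and 3. Once user 2 has found message
  -- 32, all outgoing messages of user 3 are known, and its decoder yields message 13.
  · have := sum_le_of_views h {p12, p32, p13} n₂ (fun N c => downlinkView n₂ d2 c) ?_
    · rwa [Finset.sum_insert (by decide), Finset.sum_pair (by decide), ← add_assoc] at this
    · intro N c m m' hm hm' hp hv
      have e21 := hp p21 (by decide)
      have e23 := hp p23 (by decide)
      have e31 := hp p31 (by decide)
      obtain ⟨e12, e32⟩ := eq_of_incoming_one (incoming_eq c hm hm' 1 (outgoing_eq_one e21 e23)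
        (received_snd_eq_of_downlinkView hv 1 (l2 1 (by decide))))
      obtain ⟨e13, -⟩ := eq_of_incoming_two (incoming_eq c hm hm' 2 (outgoing_eq_two e31 e32)
        (received_snd_eq_of_downlinkView hv 2 (l2 2 (by decide))))
      exact messages_ext e12 e13 e21 e23 e31 e32
  · have := sum_le_of_views h {p12, p32, p31} n₁ (fun N c => downlinkView n₁ d1 c) ?_
    · rwa [Finset.sum_insert (by decide), Finset.sum_pair (by decide), ← add_assoc] at this
    · intro N c m m' hm hm' hp hv
      have e13 := hp p13 (by decide)
      have e21 := hp p21 (by decide)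
      have e23 := hp p23 (by decide)
      obtain ⟨e12, e32⟩ := eq_of_incoming_one (incoming_eq c hm hm' 1 (outgoing_eq_one e21 e23)
        (received_snd_eq_of_downlinkView hv 1 (l1 1)))
      obtain ⟨-, e31⟩ := eq_of_incoming_zero (incoming_eq c hm hm' 0 (outgoing_eq_zero e12 e13)
        (received_snd_eq_of_downlinkView hv 0 (l1 0)))
      exact messages_ext e12 e13 e21 e23 e31 e32
  -- Here the outgoing messages of user 1 and the joint contribution of users 2 and 3 already
  -- determine every reception in the network.
  · have := sum_le_of_views h {p21, p31, p32} n₂ (fun N c => uplinkView n₂ d2 {0} c) ?_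
    · rwa [Finset.sum_insert (by decide), Finset.sum_pair (by decide), ← add_assoc] at this
    · intro N c m m' hm hm' hp hv
      have e12 := hp p12 (by decide)
      have e13 := hp p13 (by decide)
      have e23 := hp p23 (by decide)
      have o0 := outgoing_eq_zero e12 e13
      have hr := received_eq_of_uplinkView hv (fun j hj => l2 j (by simpa using hj)) (by simp [o0])
      obtain ⟨e21, e31⟩ := eq_of_incoming_zero (incoming_eq c hm hm' 0 o0 fun i => by rw [hr])
      obtain ⟨-, e32⟩ := eq_of_incoming_one
        (incoming_eq c hm hm' 1 (outgoing_eq_one e21 e23) fun i => by rw [hr])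
      exact messages_ext e12 e13 e21 e23 e31 e32
  · have := sum_le_of_views h {p21, p31, p23} n₂ (fun N c => uplinkView n₂ d2 {0} c) ?_
    · rwa [Finset.sum_insert (by decide), Finset.sum_pair (by decide), ← add_assoc] at this
    · intro N c m m' hm hm' hp hv
      have e12 := hp p12 (by decide)
      have e13 := hp p13 (by decide)
      have e32 := hp p32 (by decide)
      have o0 := outgoing_eq_zero e12 e13
      have hr := received_eq_of_uplinkView hv (fun j hj => l2 j (by simpa using hj)) (by simp [o0])
      obtain ⟨e21, e31⟩ := eq_of_incoming_zero (incoming_eq c hm hm' 0 o0 fun i => by rw [hr])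
      obtain ⟨-, e23⟩ := eq_of_incoming_two
        (incoming_eq c hm hm' 2 (outgoing_eq_two e31 e32) fun i => by rw [hr])
      exact messages_ext e12 e13 e21 e23 e31 e32
  · have := sum_le_of_views h {p13, p23, p12} n₂ (fun N c => downlinkView n₂ d2 c) ?_
    · rwa [Finset.sum_insert (by decide), Finset.sum_pair (by decide), ← add_assoc] at this
    · intro N c m m' hm hm' hp hv
      have e21 := hp p21 (by decide)
      have e31 := hp p31 (by decide)
      have e32 := hp p32 (by decide)
      obtain ⟨e13, e23⟩ := eq_of_incoming_two (incoming_eq c hm hm' 2 (outgoing_eq_two e31 e32)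
        (received_snd_eq_of_downlinkView hv 2 (l2 2 (by decide))))
      obtain ⟨e12, -⟩ := eq_of_incoming_one (incoming_eq c hm hm' 1 (outgoing_eq_one e21 e23)
        (received_snd_eq_of_downlinkView hv 1 (l2 1 (by decide))))
      exact messages_ext e12 e13 e21 e23 e31 e32
  · have := sum_le_of_views h {p13, p23, p21} n₁ (fun N c => downlinkView n₁ d1 c) ?_
    · rwa [Finset.sum_insert (by decide), Finset.sum_pair (by decide), ← add_assoc] at this
    · intro N c m m' hm hm' hp hv
      have e12 := hp p12 (by decide)
      have e31 := hp p31 (by decide)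
      have e32 := hp p32 (by decide)
      obtain ⟨e13, e23⟩ := eq_of_incoming_two (incoming_eq c hm hm' 2 (outgoing_eq_two e31 e32)
        (received_snd_eq_of_downlinkView hv 2 (l1 2)))
      obtain ⟨e21, -⟩ := eq_of_incoming_zero (incoming_eq c hm hm' 0 (outgoing_eq_zero e12 e13)
        (received_snd_eq_of_downlinkView hv 0 (l1 0)))
      exact messages_ext e12 e13 e21 e23 e31 e32

end Converse

lemma isClosed_polytope (n₁ n₂ n₃ : ℕ) : IsClosed (polytope n₁ n₂ n₃) := by
  simp only [polytope, Set.ofPred_and, Set.ofPred_forall]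
  refine (isClosed_iInter fun p => isClosed_le continuous_const (by fun_prop)).inter ?_
  iterate 7 refine (isClosed_le (by fun_prop) continuous_const).inter ?_
  exact isClosed_le (by fun_prop) continuous_const

/-! ### Pipelined block codes -/

section BlockMarkov

variable {n : Fin 3 → ℕ} {T G N : ℕ} {M : Pair → ℕ} {W : Pair → Type}

/-- The reception at user `j` after one round, when the users send one block of `T` symbols and the
relay sends the image of its received block under `F`. -/
def roundTrip (enc : ∀ j : Fin 3, (∀ k : {k : Fin 3 // k ≠ j}, W ⟨(j, k), k.2.symm⟩) →
      Fin T → Vec (dim n))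
    (F : (Fin T → Vec (dim n)) → Fin T → Vec (dim n)) (w : ∀ p, W p) (j : Fin 3) :
    Fin T → Vec (dim n) :=
  fun s => link n j (F (fun s' => ∑ l, link n l (enc l (fun k => w ⟨(l, k), k.2.symm⟩) s')) s)

lemma block_index_lt {g s : ℕ} (hg : g < G) (hs : s < T) (hN : T * (G + 1) ≤ N) :
    g * T + s < N ∧ (g + 1) * T + s < N := by
  have : (g + 2) * T ≤ (G + 1) * T := Nat.mul_le_mul_right _ (by omega)
  constructor <;> nlinarith

open Classical in
/-- The block code in which the relay processes one block of `T` symbols while it receives the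
next one. -/
noncomputable def blockCode
    (enc : ∀ j : Fin 3, (∀ k : {k : Fin 3 // k ≠ j}, W ⟨(j, k), k.2.symm⟩) →
      Fin T → Vec (dim n))
    (F : (Fin T → Vec (dim n)) → Fin T → Vec (dim n)) (hT : 0 < T) (hN : T * (G + 1) ≤ N)
    (e : ∀ p, Fin (M p) → Fin G → W p) (hM : ∀ p, 0 < M p) : Code (dim n) N M where
  userEnc j i o _ :=
    if h : (i : ℕ) / T < G then
      enc j (fun k => e _ (o k) ⟨i / T, h⟩) ⟨i % T, Nat.mod_lt _ hT⟩
    else 0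
  relayEnc i y :=
    -- In block `0` the truncated subtraction points to the current block, padded by zeros. This is
    -- harmless, as decoders look only at blocks `1, …, G`.
    F (fun s' => if h : ((i : ℕ) / T - 1) * T + s' < i then y ⟨_, h⟩ else 0)
      ⟨i % T, Nat.mod_lt _ hT⟩
  dec j y o :=
    if h : ∃ m : Messages M, outgoing m j = o ∧ ∀ (g : Fin G) (s : Fin T),
        roundTrip enc F (fun p => e p (m p) g) j s =
          y ⟨(g + 1) * T + s, (block_index_lt g.2 s.2 hN).2⟩ then
      incoming h.choose j
    else fun _ => ⟨0, hM _⟩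

/-- The decoder picks any tuple consistent with what its user knows. The true tuple is consistent,
so the choice exists; by `hdec` and injectivity of `e`, all consistent tuples agree on the incoming
messages. -/
lemma blockCode_not_isError
    (enc : ∀ j : Fin 3, (∀ k : {k : Fin 3 // k ≠ j}, W ⟨(j, k), k.2.symm⟩) →
      Fin T → Vec (dim n))
    (F : (Fin T → Vec (dim n)) → Fin T → Vec (dim n)) (hT : 0 < T) (hN : T * (G + 1) ≤ N)
    (e : ∀ p, Fin (M p) → Fin G → W p) (hM : ∀ p, 0 < M p)
    (he : ∀ p, Function.Injective (e p))
    (hdec : ∀ (w w' : ∀ p, W p) (j : Fin 3),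
      (∀ k : {k : Fin 3 // k ≠ j}, w ⟨(j, k), k.2.symm⟩ = w' ⟨(j, k), k.2.symm⟩) →
      roundTrip enc F w j = roundTrip enc F w' j →
      ∀ k : {k : Fin 3 // k ≠ j}, w ⟨(k, j), k.2⟩ = w' ⟨(k, j), k.2⟩) (m : Messages M) :
    ¬ IsError (blockCode enc F hT hN e hM) m := by
  simp only [IsError, not_exists, not_not]
  intro j
  have hdiv : ∀ g s : ℕ, s < T → (g * T + s) / T = g := fun g s hs => by
    rw [Nat.mul_comm, Nat.mul_add_div hT, Nat.div_eq_of_lt hs, add_zero]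
  have hmod : ∀ g s : ℕ, s < T → (g * T + s) % T = s := fun g s hs => by
    rw [Nat.mul_comm, Nat.mul_add_mod, Nat.mod_eq_of_lt hs]
  have hfst : ∀ (g : Fin G) (s : Fin T),
      (received (blockCode enc F hT hN e hM) m
        ⟨g * T + s, (block_index_lt g.2 s.2 hN).1⟩).1 =
      ∑ l, link n l (enc l (fun k => e _ (m ⟨(l, k), k.2.symm⟩) g) s) := by
    intro g s
    rw [received]
    simp only [blockCode, hdiv _ _ s.2, hmod _ _ s.2, g.2, dif_pos]
    rfl
  have hsnd : ∀ (g : Fin G) (s : Fin T),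
      roundTrip enc F (fun p => e p (m p) g) j s =
      (received (blockCode enc F hT hN e hM) m
        ⟨(g + 1) * T + s, (block_index_lt g.2 s.2 hN).2⟩).2 j := by
    intro g s
    rw [received]
    simp only [blockCode, hdiv _ _ s.2, hmod _ _ s.2, roundTrip, Nat.add_sub_cancel]
    congr 2
    funext s'
    have : (g : ℕ) * T + s' < (g + 1) * T + s := by have := s'.2; nlinarith
    rw [dif_pos this]
    exact (hfst g s').symm
  have hex : ∃ m' : Messages M, outgoing m' j = outgoing m j ∧ ∀ (g : Fin G) (s : Fin T),
      roundTrip enc F (fun p => e p (m' p) g) j s =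
      (received (blockCode enc F hT hN e hM) m
        ⟨(g + 1) * T + s, (block_index_lt g.2 s.2 hN).2⟩).2 j := ⟨m, rfl, hsnd⟩
  have hval : (blockCode enc F hT hN e hM).dec j
      (fun i => (received (blockCode enc F hT hN e hM) m i).2 j) (outgoing m j) =
      incoming hex.choose j := dif_pos hex
  rw [hval]
  obtain ⟨ho, hr⟩ := hex.choose_spec
  funext k
  refine he _ (funext fun g => ?_)
  refine hdec (fun p => e p (hex.choose p) g) (fun p => e p (m p) g) j (fun k => ?_)
    (funext fun s => by rw [hr, hsnd]) k
  have := congrFun ho k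
  simp only [outgoing] at this
  simp only [this]

end BlockMarkov

/-! ### Placing sums of bits on levels -/

section Levels

variable {n : Fin 3 → ℕ} {T : ℕ} {I : Type} [Fintype I]

/-- Items with requirements on the level can be placed on `T` copies of the levels. -/
lemma exists_placement (lvl : I → Fin 3)
    (h : ∀ r, Fintype.card {i // r ≤ lvl i} ≤ T * n r) :
    ∃ f : I → Fin T × Fin (dim n), Function.Injective f ∧ ∀ i, ((f i).2 : ℕ) < n (lvl i) := by
  classical
  let t : I → Finset (Fin T × Fin (dim n)) := fun i =>
    Finset.univ.filter fun x => (x.2 : ℕ) < n (lvl i)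
  have ht : ∀ i, (t i).card = T * n (lvl i) := by
    intro i
    have : t i = (Finset.univ : Finset (Fin T)) ×ˢ
        (Finset.univ.filter fun b : Fin (dim n) => (b : ℕ) < n (lvl i)) := by
      ext x; simp [t]
    rw [this, Finset.card_product, Finset.card_univ, Fintype.card_fin, Fin.card_filter_val_lt,
      min_eq_right (le_dim n _)]
  -- Hall's condition for `s`: the item of smallest `lvl` in `s` alone has enough admissible places,
  -- because `s` lies in the set of items of at least that `lvl`.
  obtain ⟨f, hf, hft⟩ := (Finset.all_card_le_biUnion_card_iff_exists_injective t).1 fun s => by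
    rcases s.eq_empty_or_nonempty with rfl | hs
    · simp
    · obtain ⟨i, hi, hmin⟩ := s.exists_min_image lvl hs
      calc s.card ≤ (Finset.univ.filter fun i' => lvl i ≤ lvl i').card :=
            Finset.card_le_card fun i' hi' => by simpa using hmin i' hi'
        _ ≤ T * n (lvl i) := by rw [← Fintype.card_subtype]; exact h _
        _ = (t i).card := (ht i).symm
        _ ≤ (s.biUnion t).card := Finset.card_le_card (Finset.subset_biUnion_of_mem t hi)
  exact ⟨f, hf, fun i => by simpa [t] using hft i⟩

variable {W : Pair → Type}

/-- If the contributions `v` of the users to a family of items, and the items themselves on the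
downlink, fit on the levels, then one round delivers to every user the sums of the contributions
to the items of sufficient downlink level. -/
lemma exists_roundTrip (hn : Antitone n) (lu ld : I → Fin 3)
    (hu : ∀ r, Fintype.card {i // r ≤ lu i} ≤ T * n r)
    (hd : ∀ r, Fintype.card {i // r ≤ ld i} ≤ T * n r)
    (v : ∀ j : Fin 3, (∀ k : {k : Fin 3 // k ≠ j}, W ⟨(j, k), k.2.symm⟩) → I → ZMod 2)
    (hv : ∀ j o i, lu i < j → v j o i = 0) :
    ∃ (enc : ∀ j : Fin 3, (∀ k : {k : Fin 3 // k ≠ j}, W ⟨(j, k), k.2.symm⟩) →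
        Fin T → Vec (dim n)) (F : (Fin T → Vec (dim n)) → Fin T → Vec (dim n)),
      ∀ (w w' : ∀ p, W p) (j : Fin 3), roundTrip enc F w j = roundTrip enc F w' j →
        ∀ i, j ≤ ld i → ∑ l, v l (fun k => w ⟨(l, k), k.2.symm⟩) i =
          ∑ l, v l (fun k => w' ⟨(l, k), k.2.symm⟩) i := by
  obtain ⟨fu, hfu, hlu⟩ := exists_placement lu hu
  obtain ⟨fd, hfd, hld⟩ := exists_placement ld hd
  -- User `j` reaches the bottom `n j` entries at the relay but hears the top `n j` entries of its
  -- signal. `Fin.rev` lets one placement lemma serve both directions.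
  have henc : ∀ j o s, ∃ x : Vec (dim n), link n j x =
      fun a => Function.extend fu (v j o) 0 (s, Fin.rev a) := by
    intro j o s
    refine exists_link_eq j _ fun a ha => ?_
    by_cases h : ∃ i, fu i = (s, Fin.rev a)
    · obtain ⟨i, hi⟩ := h
      rw [← hi, hfu.extend_apply]
      refine hv j o i (lt_of_not_ge fun hj => ?_)
      have h1 := hlu i
      have h2 := hn hj
      rw [hi, Fin.val_rev] at h1
      omega
    · rw [Function.extend_apply' _ _ _ h]; rfl
  choose enc henc using henc
  let F : (Fin T → Vec (dim n)) → Fin T → Vec (dim n) :=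
    fun y s b => Function.extend fd (fun i => y (fu i).1 (Fin.rev (fu i).2)) 0 (s, b)
  have key : ∀ (w : ∀ p, W p) (j : Fin 3) i (hj : j ≤ ld i),
      roundTrip enc F w j (fd i).1
        ⟨(fd i).2 + (dim n - n j), by have := hld i; have := hn hj; have := le_dim n j; omega⟩ =
      ∑ l, v l (fun k => w ⟨(l, k), k.2.symm⟩) i := by
    intro w j i hj
    rw [roundTrip, link_read j _ (fd i).2 ((hld i).trans_le (hn hj))]
    simp only [F, Prod.mk.eta, hfd.extend_apply, Finset.sum_apply, henc, Fin.rev_rev,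
      hfu.extend_apply]
  exact ⟨enc, F, fun w w' j h i hi => by rw [← key w j i hi, ← key w' j i hi, h]⟩

end Levels

/-! ### The eleven coding strategies -/

section Items

/-- The sums of message bits that the relay forwards. The items `0, 1, 2` exchange bits in the two
directions between two users, the items `3, 11` and `4, 12` deliver three bits along the two
oriented cycles, and the items `5, …, 10` deliver single bits. -/
def itemPairs : Fin 13 → Finset Pair :=
  ![{p12, p21}, {p13, p31}, {p23, p32}, {p12, p23}, {p21, p13}, {p12}, {p13}, {p21}, {p23}, {p31},
    {p32}, {p23, p31}, {p13, p32}]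

/-- The strategy to which an item belongs. -/
def itemStrategy : Fin 13 → Fin 11 := ![0, 1, 2, 3, 4, 5, 6, 7, 8, 9, 10, 3, 4]

/-- The weakest user that contributes to an item. -/
def itemUp : Fin 13 → Fin 3 := ![1, 2, 2, 1, 1, 0, 0, 1, 1, 2, 2, 2, 2]

/-- The weakest user that has to receive an item. -/
def itemDown : Fin 13 → Fin 3 := ![1, 2, 2, 1, 1, 1, 2, 0, 2, 0, 1, 2, 2]

/-- The messages of which a strategy delivers one bit. -/
def strategyPairs : Fin 11 → Finset Pair :=
  ![{p12, p21}, {p13, p31}, {p23, p32}, {p12, p23, p31}, {p21, p13, p32}, {p12}, {p13}, {p21},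
    {p23}, {p31}, {p32}]

lemma itemUp_spec : ∀ t, ∀ p ∈ itemPairs t, p.1.1 ≤ itemUp t := by decide

/-- By linearity, unique decoding is a kernel statement: `x` is the difference of two bit
assignments that agree on the bits of user `j` and on the sums it receives. -/
lemma strategy_decodable (τ : Fin 11) (x : Pair → ZMod 2) (j : Fin 3)
    (hx : ∀ p : Pair, p.1.1 = j → x p = 0)
    (hs : ∀ t, itemStrategy t = τ → j ≤ itemDown t → ∑ p ∈ itemPairs t, x p = 0) :
    ∀ p ∈ strategyPairs τ, p.1.2 = j → x p = 0 := by
  have a1 : p12 ≠ p21 := by decide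
  have a2 : p13 ≠ p31 := by decide
  have a3 : p23 ≠ p32 := by decide
  have a4 : p12 ≠ p23 := by decide
  have a5 : p21 ≠ p13 := by decide
  have a6 : p23 ≠ p31 := by decide
  have a7 : p13 ≠ p32 := by decide
  have b12 := hx p12
  have b13 := hx p13
  have b21 := hx p21
  have b23 := hx p23
  have b31 := hx p31
  have b32 := hx p32
  simp only [Fin.forall_fin_succ] at hs
  fin_cases τ <;> simp [itemStrategy, itemDown, itemPairs, strategyPairs, *] at hs ⊢ <;>
    fin_cases j <;> simp [p12, p13, p21, p23, p31, p32] at * <;> simp_all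
  -- Successive decoding in a cycle: one sum yields the middle bit, which is then cancelled from the
  -- other sum.
  all_goals
    rw [hs.1, zero_add] at hs
    exact hs.2

variable (c : Fin 11 → ℕ)

/-- The number of bits of message `p` delivered when strategy `τ` is used `c τ` times. -/
def bits (p : Pair) : ℕ := ∑ τ, if p ∈ strategyPairs τ then c τ else 0

/-- The number of items of level at least `r`. -/
def load (lvl : Fin 13 → Fin 3) (r : Fin 3) : ℕ :=
  ∑ t, if r ≤ lvl t then c (itemStrategy t) else 0

/-- The bits of message `p` in one block. -/
abbrev Block (p : Pair) : Type := ∀ τ : {τ : Fin 11 // p ∈ strategyPairs τ}, Fin (c τ) → ZMod 2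

lemma card_block (p : Pair) : Fintype.card (Block c p) = 2 ^ bits c p := by
  rw [Fintype.card_pi]
  simp only [Fintype.card_fun, ZMod.card, Fintype.card_fin]
  rw [Finset.prod_pow_eq_pow_sum, bits, ← Finset.sum_filter,
    Finset.sum_subtype (p := fun τ => p ∈ strategyPairs τ) _ (by simp)]

variable {c}

/-- A bit of a block, `0` if the message is not delivered by the strategy. -/
def Block.bit {p : Pair} (w : Block c p) (τ : Fin 11) (a : Fin (c τ)) : ZMod 2 :=
  if h : p ∈ strategyPairs τ then w ⟨τ, h⟩ a else 0

lemma card_items (lvl : Fin 13 → Fin 3) (r : Fin 3) :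
    Fintype.card {i : (t : Fin 13) × Fin (c (itemStrategy t)) // r ≤ lvl i.1} = load c lvl r := by
  rw [Fintype.card_subtype, Finset.card_filter, Fintype.sum_sigma, load]
  refine Finset.sum_congr rfl fun t _ => ?_
  split_ifs <;> simp

/-- The contribution of user `j` to an item. -/
def contribution (j : Fin 3) (o : ∀ k : {k : Fin 3 // k ≠ j}, Block c ⟨(j, k), k.2.symm⟩)
    (i : (t : Fin 13) × Fin (c (itemStrategy t))) : ZMod 2 :=
  ∑ k : {k : Fin 3 // k ≠ j}, if (⟨(j, k), k.2.symm⟩ : Pair) ∈ itemPairs i.1 then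
    (o k).bit (itemStrategy i.1) i.2 else 0

lemma sum_pairs (f : Pair → ZMod 2) :
    ∑ j, ∑ k : {k : Fin 3 // k ≠ j}, f ⟨(j, k), k.2.symm⟩ = ∑ p, f p := by
  rw [← Fintype.sum_sigma']
  exact Fintype.sum_equiv
    { toFun := fun x => ⟨(x.1, x.2), x.2.2.symm⟩
      invFun := fun p => ⟨p.1.1, p.1.2, p.2.symm⟩
      left_inv := fun _ => rfl
      right_inv := fun _ => rfl } _ _ fun _ => rfl

lemma sum_contribution (w : ∀ p, Block c p) (i : (t : Fin 13) × Fin (c (itemStrategy t))) :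
    ∑ j, contribution j (fun k => w ⟨(j, k), k.2.symm⟩) i =
      ∑ p ∈ itemPairs i.1, (w p).bit (itemStrategy i.1) i.2 := by
  have h := Finset.sum_ite_mem Finset.univ (itemPairs i.1)
    fun p => (w p).bit (itemStrategy i.1) i.2
  rw [Finset.univ_inter] at h
  rw [← h, ← sum_pairs]
  rfl

lemma exists_code_of_bits {n : Fin 3 → ℕ} (hn : Antitone n) {T G N : ℕ} {M : Pair → ℕ} (hT : 0 < T)
    (hN : T * (G + 1) ≤ N) (hM : ∀ p, 0 < M p) (hM' : ∀ p, M p ≤ 2 ^ (bits c p * G))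
    (hu : ∀ r, load c itemUp r ≤ T * n r) (hd : ∀ r, load c itemDown r ≤ T * n r) :
    ∃ C : Code (dim n) N M, ∀ m, ¬ IsError C m := by
  obtain ⟨enc, F, h⟩ := exists_roundTrip (T := T) hn
    (fun i : (t : Fin 13) × Fin (c (itemStrategy t)) => itemUp i.1) (fun i => itemDown i.1)
    (fun r => by rw [card_items]; exact hu r) (fun r => by rw [card_items]; exact hd r)
    (contribution (c := c)) (fun j o i hi => Finset.sum_eq_zero fun k _ => if_neg fun hk =>
      (itemUp_spec _ _ hk).not_gt hi)
  have he : ∀ p, Nonempty (Fin (M p) ↪ (Fin G → Block c p)) := fun p => by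
    refine Function.Embedding.nonempty_of_card_le ?_
    rw [Fintype.card_fun, card_block, Fintype.card_fin, Fintype.card_fin, ← pow_mul]
    exact hM' p
  refine ⟨blockCode enc F hT hN (fun p => (he p).some) hM, blockCode_not_isError enc F hT hN _ hM
    (fun p => (he p).some.injective) fun w w' j ho hr k => ?_⟩
  have hsum := h w w' j hr
  simp only [sum_contribution] at hsum
  funext τ a
  -- Each use `a` of each strategy is decoded separately.
  have := strategy_decodable τ.1 (fun p => (w p).bit τ.1 a - (w' p).bit τ.1 a) j ?_ ?_
    ⟨(k, j), k.2⟩ τ.2 rfl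
  · simpa [Block.bit, τ.2, sub_eq_zero] using this
  · rintro ⟨⟨j', l⟩, hl⟩ rfl
    simp only at *
    rw [ho ⟨l, fun h => hl h.symm⟩, sub_self]
  · rintro t ht hj
    obtain ⟨τ, hτ⟩ := τ
    subst ht
    rw [Finset.sum_sub_distrib, hsum ⟨t, a⟩ hj, sub_self]

end Items

/-! ### Integer decomposition of rate tuples into strategies -/

lemma bits_eq (c : Fin 11 → ℕ) :
    bits c p12 = c 0 + c 3 + c 5 ∧ bits c p13 = c 1 + c 4 + c 6 ∧ bits c p21 = c 0 + c 4 + c 7 ∧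
      bits c p23 = c 2 + c 3 + c 8 ∧ bits c p31 = c 1 + c 3 + c 9 ∧
      bits c p32 = c 2 + c 4 + c 10 := by
  have h : ∀ (p : Pair) (s : Finset (Fin 11)),
      (Finset.univ.filter fun τ => p ∈ strategyPairs τ) = s → bits c p = ∑ τ ∈ s, c τ := by
    rintro p _ rfl
    rw [bits, Finset.sum_filter]
  refine ⟨?_, ?_, ?_, ?_, ?_, ?_⟩
  · rw [h p12 {0, 3, 5} (by decide)]; simp [add_assoc]
  · rw [h p13 {1, 4, 6} (by decide)]; simp [add_assoc]
  · rw [h p21 {0, 4, 7} (by decide)]; simp [add_assoc]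
  · rw [h p23 {2, 3, 8} (by decide)]; simp [add_assoc]
  · rw [h p31 {1, 3, 9} (by decide)]; simp [add_assoc]
  · rw [h p32 {2, 4, 10} (by decide)]; simp [add_assoc]

lemma load_itemUp_eq (c : Fin 11 → ℕ) :
    load c itemUp 2 = c 1 + c 2 + c 9 + c 10 + c 3 + c 4 ∧
      load c itemUp 1 = load c itemUp 2 + c 0 + c 3 + c 4 + c 7 + c 8 ∧
      load c itemUp 0 = load c itemUp 1 + c 5 + c 6 := by
  simp [load, Fin.sum_univ_succ, itemUp, itemStrategy]
  omega

lemma load_itemDown_eq (c : Fin 11 → ℕ) :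
    load c itemDown 2 = c 1 + c 2 + c 6 + c 8 + c 3 + c 4 ∧
      load c itemDown 1 = load c itemDown 2 + c 0 + c 3 + c 4 + c 5 + c 10 ∧
      load c itemDown 0 = load c itemDown 1 + c 7 + c 9 := by
  simp [load, Fin.sum_univ_succ, itemDown, itemStrategy]
  omega

/-- For each pair of users the smaller rate is paired off, and the larger rates orient the triangle.
In the six transitive cases the total load is the sum of the larger rates, which one of the
genie-aided bounds controls. The two cyclic cases need the strategies `3` and `4`. -/
lemma exists_decomposition (r12 r13 r21 r23 r31 r32 a b d : ℕ)
    (h1 : r31 + r32 ≤ d) (h2 : r13 + r23 ≤ d) (h3 : r12 + r32 + r13 ≤ b) (h4 : r12 + r32 + r31 ≤ a)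
    (h5 : r21 + r31 + r32 ≤ b) (h6 : r21 + r31 + r23 ≤ b) (h7 : r13 + r23 + r12 ≤ b)
    (h8 : r13 + r23 + r21 ≤ a) (hab : b ≤ a) :
    ∃ c0 c1 c2 c3 c4 c5 c6 c7 c8 c9 c10 : ℕ,
      (r12 = c0 + c3 + c5 ∧ r13 = c1 + c4 + c6 ∧ r21 = c0 + c4 + c7 ∧ r23 = c2 + c3 + c8 ∧
        r31 = c1 + c3 + c9 ∧ r32 = c2 + c4 + c10) ∧
      c0 + c1 + c2 + 2 * c3 + 2 * c4 + c7 + c8 + c9 + c10 ≤ b ∧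
      c0 + c1 + c2 + 2 * c3 + 2 * c4 + c5 + c6 + c8 + c10 ≤ b ∧
      c0 + c1 + c2 + 2 * c3 + 2 * c4 + c5 + c6 + c7 + c8 + c9 + c10 ≤ a := by
  rcases le_total r12 r21 with h | h <;> obtain ⟨x, rfl⟩ := Nat.exists_eq_add_of_le h <;>
  rcases le_total r23 r32 with h' | h' <;> obtain ⟨y, rfl⟩ := Nat.exists_eq_add_of_le h' <;>
  rcases le_total r31 r13 with h'' | h'' <;> obtain ⟨z, rfl⟩ := Nat.exists_eq_add_of_le h''
  -- The surpluses of messages 21, 32, 13 form a cycle. Coding `f` of each costs `2 * f` instead of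
  -- `3 * f`, so the total is the sum of the larger rates minus the smallest surplus. This replaces
  -- one larger rate by its reverse and makes the triple transitive.
  · obtain ⟨f, hx, hy, hz, hf⟩ : ∃ f, f ≤ x ∧ f ≤ y ∧ f ≤ z ∧ (f = x ∨ f = y ∨ f = z) :=
      ⟨min (min x y) z, by omega⟩
    exact ⟨r12, r31, r23, 0, f, 0, z - f, x - f, 0, 0, y - f, by omega, by omega, by omega,
      by omega⟩
  · exact ⟨r12, r13, r23, 0, 0, 0, 0, x, 0, z, y, by omega, by omega, by omega, by omega⟩
  · exact ⟨r12, r31, r32, 0, 0, 0, z, x, y, 0, 0, by omega, by omega, by omega, by omega⟩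
  · exact ⟨r12, r13, r32, 0, 0, 0, 0, x, y, z, 0, by omega, by omega, by omega, by omega⟩
  · exact ⟨r21, r31, r23, 0, 0, x, z, 0, 0, 0, y, by omega, by omega, by omega, by omega⟩
  · exact ⟨r21, r13, r23, 0, 0, x, 0, 0, 0, z, y, by omega, by omega, by omega, by omega⟩
  · exact ⟨r21, r31, r32, 0, 0, x, z, 0, y, 0, 0, by omega, by omega, by omega, by omega⟩
  · obtain ⟨e, hx, hy, hz, he⟩ : ∃ e, e ≤ x ∧ e ≤ y ∧ e ≤ z ∧ (e = x ∨ e = y ∨ e = z) :=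
      ⟨min (min x y) z, by omega⟩
    exact ⟨r21, r13, r32, e, 0, x - e, 0, 0, y - e, z - e, 0, by omega, by omega, by omega,
      by omega⟩

/-- The loads at level `2` are exactly `r31 + r32` and `r13 + r23`, so the cut-set bounds settle
them; the other levels use the three inequalities of `exists_decomposition`. -/
lemma exists_strategy_counts (r12 r13 r21 r23 r31 r32 a b d : ℕ) (hab : b ≤ a)
    (h1 : r31 + r32 ≤ d) (h2 : r13 + r23 ≤ d) (h3 : r12 + r32 + r13 ≤ b) (h4 : r12 + r32 + r31 ≤ a)
    (h5 : r21 + r31 + r32 ≤ b) (h6 : r21 + r31 + r23 ≤ b) (h7 : r13 + r23 + r12 ≤ b)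
    (h8 : r13 + r23 + r21 ≤ a) :
    ∃ c : Fin 11 → ℕ, bits c p12 = r12 ∧ bits c p13 = r13 ∧ bits c p21 = r21 ∧ bits c p23 = r23 ∧
      bits c p31 = r31 ∧ bits c p32 = r32 ∧
      (∀ r, load c itemUp r ≤ ![a, b, d] r) ∧ (∀ r, load c itemDown r ≤ ![a, b, d] r) := by
  obtain ⟨c0, c1, c2, c3, c4, c5, c6, c7, c8, c9, c10, hr, k1, k2, k3⟩ :=
    exists_decomposition r12 r13 r21 r23 r31 r32 a b d h1 h2 h3 h4 h5 h6 h7 h8 hab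
  obtain ⟨c, rfl, rfl, rfl, rfl, rfl, rfl, rfl, rfl, rfl, rfl, rfl⟩ : ∃ c : Fin 11 → ℕ,
      c 0 = c0 ∧ c 1 = c1 ∧ c 2 = c2 ∧ c 3 = c3 ∧ c 4 = c4 ∧ c 5 = c5 ∧ c 6 = c6 ∧ c 7 = c7 ∧
      c 8 = c8 ∧ c 9 = c9 ∧ c 10 = c10 :=
    ⟨![_, _, _, _, _, _, _, _, _, _, _], rfl, rfl, rfl, rfl, rfl, rfl, rfl, rfl, rfl, rfl, rfl⟩
  obtain ⟨b1, b2, b3, b4, b5, b6⟩ := bits_eq c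
  obtain ⟨u2, u1, u0⟩ := load_itemUp_eq c
  obtain ⟨d2, d1, d0⟩ := load_itemDown_eq c
  refine ⟨c, ?_, ?_, ?_, ?_, ?_, ?_, ?_, ?_⟩
  · omega
  · omega
  · omega
  · omega
  · omega
  · omega
  · rw [Fin.forall_fin_succ, Fin.forall_fin_two]
    refine ⟨?_, ?_, ?_⟩
    · change load c itemUp 0 ≤ a
      omega
    · change load c itemUp 1 ≤ b
      omega
    · change load c itemUp 2 ≤ d
      omega
  · rw [Fin.forall_fin_succ, Fin.forall_fin_two]
    refine ⟨?_, ?_, ?_⟩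
    · change load c itemDown 0 ≤ a
      omega
    · change load c itemDown 1 ≤ b
      omega
    · change load c itemDown 2 ≤ d
      omega

/-! ### From integer points to the whole polytope -/

section Achievability

variable {n₁ n₂ n₃ : ℕ}

lemma achievable_of_eventually {n : Fin 3 → ℕ} {R : Pair → ℝ} (hR : ∀ p, 0 ≤ R p)
    (h : ∀ᶠ N in Filter.atTop, ∃ C : Code (dim n) N (messageSize R N), ∀ m, ¬ IsError C m) :
    Achievable n R := by
  classical
  -- A trivial code fills in the block lengths for which no error-free code exists.
  refine ⟨hR, fun N => if h : ∃ C : Code (dim n) N (messageSize R N), ∀ m, ¬ IsError C m then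
    h.choose else ⟨fun _ _ _ _ => 0, fun _ _ => 0, fun _ _ _ _ => ⟨0, messageSize_pos hR N _⟩⟩, ?_⟩
  refine tendsto_const_nhds.congr' ?_
  filter_upwards [h] with N hN
  rw [dif_pos hN, errorProb, Finset.filter_false_of_mem fun m _ => hN.choose_spec m]
  simp

/-- An integer point of the polytope of the `T`-fold extended channel, scaled by a bit less than
`1 / T`, is achievable. -/
lemma achievable_of_natCast {T : ℕ} (hT : 0 < T) (h₁₂ : n₂ ≤ n₁) (h₂₃ : n₃ ≤ n₂) (κ : Pair → ℕ)
    (hκ : (fun p => (κ p : ℝ)) ∈ polytope (T * n₁) (T * n₂) (T * n₃)) {θ : ℝ} (hθ : 0 ≤ θ)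
    (hθ' : θ < 1) : Achievable ![n₁, n₂, n₃] (fun p => θ * (κ p / T)) := by
  have hn : Antitone ![n₁, n₂, n₃] := by
    intro i j hij
    fin_cases i <;> fin_cases j <;> simp at hij ⊢ <;> omega
  obtain ⟨-, h1, h2, h3, h4, h5, h6, h7, h8⟩ := hκ
  beta_reduce at h1 h2 h3 h4 h5 h6 h7 h8
  norm_cast at h1 h2 h3 h4 h5 h6 h7 h8
  obtain ⟨c, b12, b13, b21, b23, b31, b32, hu, hd⟩ := exists_strategy_counts _ _ _ _ _ _ _ _ _
    (Nat.mul_le_mul_left T h₁₂) h1 h2 h3 h4 h5 h6 h7 h8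
  have hb : ∀ p, bits c p = κ p := forall_pair b12 b13 b21 b23 b31 b32
  have hscale : ![T * n₁, T * n₂, T * n₃] = fun r => T * ![n₁, n₂, n₃] r := by
    funext r; fin_cases r <;> rfl
  rw [hscale] at hu hd
  have hT' : (0 : ℝ) < T := by exact_mod_cast hT
  have hR : ∀ p, 0 ≤ θ * ((κ p : ℝ) / T) := fun p => by positivity
  refine achievable_of_eventually hR ?_
  -- The slack `1 - θ` pays for the one-block delay and for the fewer than `T` slots left over when
  -- `N` is divided by `T`.
  have hlarge : ∀ᶠ N : ℕ in Filter.atTop, (2 * T : ℝ) < (N : ℝ) * (1 - θ) :=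
    (tendsto_natCast_atTop_atTop.atTop_mul_const (sub_pos.2 hθ')).eventually_gt_atTop _
  filter_upwards [hlarge, Filter.eventually_ge_atTop T] with N hN hNT
  have hdiv : 1 ≤ N / T := (Nat.one_le_div_iff hT).2 hNT
  refine exists_code_of_bits (c := c) hn (T := T) (G := N / T - 1) hT ?_ (messageSize_pos hR N)
    (fun p => ?_) hu hd
  · rw [Nat.sub_add_cancel hdiv]
    exact Nat.mul_div_le N T
  · have hG : (N : ℝ) * θ ≤ T * ((N / T - 1 : ℕ) : ℝ) := by
      have h1 : N < T * (N / T) + T := Nat.lt_mul_div_succ N hT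
      have h2 : (N : ℝ) < T * ((N / T : ℕ) : ℝ) + T := by exact_mod_cast h1
      rw [Nat.cast_sub hdiv]
      push_cast at h2 ⊢
      nlinarith
    have hle : (N : ℝ) * (θ * ((κ p : ℝ) / T)) ≤ (bits c p * (N / T - 1) : ℕ) := by
      rw [hb]
      push_cast
      have := mul_le_mul_of_nonneg_left hG (show (0 : ℝ) ≤ κ p / T by positivity)
      calc (N : ℝ) * (θ * ((κ p : ℝ) / T)) = κ p / T * (N * θ) := by ring
        _ ≤ _ := this
        _ = _ := by field_simp
    have h2 : (2 : ℝ) ^ ((N : ℝ) * (θ * ((κ p : ℝ) / T))) ≤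
        ((2 ^ (bits c p * (N / T - 1)) : ℕ) : ℝ) := by
      push_cast
      rw [← Real.rpow_natCast]
      exact Real.rpow_le_rpow_of_exponent_le (by norm_num) hle
    exact Nat.floor_le_of_le h2

lemma floor_mem_polytope {R : Pair → ℝ} (hR : R ∈ polytope n₁ n₂ n₃) (T : ℕ) :
    (fun p => ((⌊R p * T⌋₊ : ℕ) : ℝ)) ∈ polytope (T * n₁) (T * n₂) (T * n₃) := by
  obtain ⟨h0, h1, h2, h3, h4, h5, h6, h7, h8⟩ := hR
  have hf : ∀ p, ((⌊R p * T⌋₊ : ℕ) : ℝ) ≤ R p * T := fun p =>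
    Nat.floor_le (mul_nonneg (h0 p) (Nat.cast_nonneg T))
  have f12 := hf p12
  have f13 := hf p13
  have f21 := hf p21
  have f23 := hf p23
  have f31 := hf p31
  have f32 := hf p32
  have hT : (0 : ℝ) ≤ T := Nat.cast_nonneg T
  refine ⟨fun p => Nat.cast_nonneg _, ?_, ?_, ?_, ?_, ?_, ?_, ?_, ?_⟩ <;> push_cast
  · linarith [mul_le_mul_of_nonneg_left h1 hT]
  · linarith [mul_le_mul_of_nonneg_left h2 hT]
  · linarith [mul_le_mul_of_nonneg_left h3 hT]
  · linarith [mul_le_mul_of_nonneg_left h4 hT]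
  · linarith [mul_le_mul_of_nonneg_left h5 hT]
  · linarith [mul_le_mul_of_nonneg_left h6 hT]
  · linarith [mul_le_mul_of_nonneg_left h7 hT]
  · linarith [mul_le_mul_of_nonneg_left h8 hT]

lemma polytope_subset_capacityRegion (h₁₂ : n₂ ≤ n₁) (h₂₃ : n₃ ≤ n₂) :
    polytope n₁ n₂ n₃ ⊆ capacityRegion ![n₁, n₂, n₃] := by
  intro R hR
  -- The factor `1 - 1 / (T + 1)` serves as `θ < 1` and tends to 1, so the achievable scaled floor
  -- points converge to `R`.
  have hlim : Filter.Tendsto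
      (fun (T : ℕ) p => (1 - 1 / ((T : ℝ) + 1)) * (((⌊R p * T⌋₊ : ℕ) : ℝ) / T))
      Filter.atTop (nhds R) := by
    rw [tendsto_pi_nhds]
    intro p
    have h1 : Filter.Tendsto (fun T : ℕ => 1 - 1 / ((T : ℝ) + 1)) Filter.atTop (nhds (1 - 0)) :=
      tendsto_const_nhds.sub tendsto_one_div_add_atTop_nhds_zero_nat
    have h2 := (tendsto_nat_floor_mul_div_atTop (hR.1 p)).comp
      (tendsto_natCast_atTop_atTop (R := ℝ))
    simpa using h1.mul h2
  refine mem_closure_of_tendsto hlim ?_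
  filter_upwards [Filter.eventually_gt_atTop 0] with T hT
  refine achievable_of_natCast hT h₁₂ h₂₃ _ (floor_mem_polytope hR T) ?_ ?_
  · have : 1 / ((T : ℝ) + 1) ≤ 1 := by
      rw [div_le_one (by positivity)]
      linarith [(Nat.cast_nonneg T : (0 : ℝ) ≤ T)]
    linarith
  · have : 0 < 1 / ((T : ℝ) + 1) := by positivity
    linarith

end Achievability

end DYC

theorem theorem4 (n₁ n₂ n₃ : ℕ) (h₁₂ : n₂ ≤ n₁) (h₂₃ : n₃ ≤ n₂) :
    DYC.capacityRegion ![n₁, n₂, n₃] = DYC.polytope n₁ n₂ n₃ := by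
  refine Set.Subset.antisymm ?_ (DYC.polytope_subset_capacityRegion h₁₂ h₂₃)
  exact closure_minimal (fun R hR => DYC.achievable_mem_polytope h₁₂ h₂₃ hR)
    (DYC.isClosed_polytope n₁ n₂ n₃)
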